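/- Let $(E_0,(\cdot|\cdot))$ be a real or complex Hilbert space and let $A$ be a closed, densely defined, self-adjoint operator on $E_0$ with compact resolvent which is bounded above by some $\alpha\in\mathbb R$, i.e. $(Ax|x)\le\alpha\|x\|^2$ for $x\in\mathrm{dom}(A)$. Then $A$ generates a strongly continuous semigroup $(e^{tA})_{t\ge0}$ on $E_0$, and its spectrum $\sigma(A)$ consists of countably many real eigenvalues of finite multiplicity $\alpha\ge\lambda_1\ge\lambda_2\ge\cdots$ (listed according to multiplicity; $\lambda_j\to-\infty$ if $\dim E_0=\infty$, and the list is finite if $\dim E_0<\infty$). Let $T>0$; the integrals $\int_0^T b(t)e^{tA}\,dt$ below converge as Bochner integrals in the space of bounded operators on $E_0$, and $\sigma_p$ denotes the point spectrum (the set of eigenvalues). (a) Let $a\in\mathbb R$, $b\in C([0,T],\mathbb R)$ and $\Phi_T:=a\,e^{TA}+\int_0^T b(t)\,e^{tA}\,dt$. Then $\ker\Phi_T=\{0\}$ if and only if $$-a\ne\int_0^T b(t)\,e^{-\lambda_j(T-t)}\,dt\quad\text{for all } j.$$ In particular, if $b\ge0$, then $\ker\Phi_T=\{0\}$ whenever either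 $a\ge0$ and $b(0)>0$, or $\alpha\le0$ and $\int_0^T b(t)\,dt>-a$. (b) Let $b\in\mathbb R\setminus\{0\}$. Then $1\notin b\,e^{T\sigma(A)}:=\{b\,e^{Tz} : z\in\sigma(A)\}$ if and only if $1\ne b\,e^{\lambda_jT}$ for all $j$. In particular, $1\notin b\,e^{T\sigma(A)}$ whenever $b\le1$ and $\alpha<0$. (c) Let $b\in C([0,T],\mathbb R)$. Then $-1\notin\sigma_p\big(\int_0^T b(t)\,e^{tA}\,dt\big)$ if and only if $$-1\ne\int_0^T b(t)\,e^{\lambda_jt}\,dt\quad\text{for all } j.$$ In particular, $-1\notin\sigma_p\big(\int_0^T b(t)\,e^{tA}\,dt\big)$ whenever $b\ge0$. -/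

import Mathlib

open MeasureTheory Filter Topology Set

noncomputable section

namespace NonlocalEvolution

variable {𝕜 E : Type*} [RCLike 𝕜] [NormedAddCommGroup E] [InnerProductSpace 𝕜 E]

/-- `R` is the bounded inverse `(z - A)⁻¹` of `z - A : dom A → E`. -/
def IsResolventAt (A : E →ₗ.[𝕜] E) (z : 𝕜) (R : E →L[𝕜] E) : Prop :=
  (∀ y : E, ∃ h : R y ∈ A.domain, z • R y - A ⟨R y, h⟩ = y) ∧
    ∀ x : A.domain, R (z • (x : E) - A x) = x

/-- The resolvent set of an unbounded operator. -/
def resolventSet (A : E →ₗ.[𝕜] E) : Set 𝕜 :=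
  {z | ∃ R : E →L[𝕜] E, IsResolventAt A z R}

/-- The spectrum of an unbounded operator. -/
def spectrum (A : E →ₗ.[𝕜] E) : Set 𝕜 := (resolventSet A)ᶜ

/-- The resolvent set is non-empty and some resolvent operator is compact
(by the resolvent identity, then all of them are). -/
def HasCompactResolvent (A : E →ₗ.[𝕜] E) : Prop :=
  ∃ (z : 𝕜) (R : E →L[𝕜] E), IsResolventAt A z R ∧ IsCompactOperator R

/-- `A ≤ α` in the sense of quadratic forms on the domain of `A`. -/
def BoundedAboveBy (A : E →ₗ.[𝕜] E) (α : ℝ) : Prop :=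
  ∀ x : A.domain, RCLike.re (inner 𝕜 (A x) (x : E)) ≤ α * ‖(x : E)‖ ^ 2

/-- `ker (A - μ)`: all `x` in the domain of `A` with `A x = μ x`. -/
def eigenspace (A : E →ₗ.[𝕜] E) (μ : 𝕜) : Submodule 𝕜 E :=
  A.graph.comap (LinearMap.prod LinearMap.id (μ • LinearMap.id))

/-- The family `lam`, indexed by the first `N ≤ ∞` natural numbers, lists the eigenvalues of `A`
in non-increasing order, each one repeated according to its multiplicity, and tends to `-∞` if
it is infinite. (The index set is finite exactly if the space is finite-dimensional; convergence
along the cofinite filter is automatic in that case.) -/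
structure IsEigenvalueEnumeration (A : E →ₗ.[𝕜] E) (N : ℕ∞)
    (lam : {j : ℕ // (j : ℕ∞) < N} → ℝ) : Prop where
  antitone : Antitone lam
  tendsto : Tendsto lam cofinite atBot
  multiplicity : ∀ μ : 𝕜,
    {j | ((lam j : ℝ) : 𝕜) = μ}.encard = Cardinal.toENat (Module.rank 𝕜 (eigenspace A μ))

/-- `S` restricted to `[0, ∞)` is a strongly continuous semigroup of bounded operators. -/
structure IsC0Semigroup (S : ℝ → E →L[𝕜] E) : Prop where
  zero : S 0 = 1
  add : ∀ s t : ℝ, 0 ≤ s → 0 ≤ t → S (s + t) = S s * S t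
  continuousOn : ∀ x : E, ContinuousOn (fun t => S t x) (Ici 0)

/-- `A` is the infinitesimal generator of `S`: `x ∈ dom A` with `A x = y` if and only if
`(S h x - x) / h → y` as `h → 0+`. -/
def IsGenerator (A : E →ₗ.[𝕜] E) (S : ℝ → E →L[𝕜] E) : Prop :=
  ∀ x y : E, (x, y) ∈ A.graph ↔
    Tendsto (fun h : ℝ => ((h⁻¹ : ℝ) : 𝕜) • (S h x - x)) (𝓝[>] 0) (𝓝 y)

open Classical in
/-- The operators `e^{tA}`, `t ≥ 0`: the strongly continuous semigroup generated by `A`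
(and `0` if `A` is not a generator; values at `t < 0` carry no meaning). -/
def opExp (A : E →ₗ.[𝕜] E) : ℝ → E →L[𝕜] E :=
  if h : ∃ S : ℝ → E →L[𝕜] E, IsC0Semigroup S ∧ IsGenerator A S then h.choose else 0

/-- The Bochner integral `∫₀ᵀ b(t) e^{tA} dt` in the space of bounded operators. -/
def averagedSemigroup (A : E →ₗ.[𝕜] E) (T : ℝ) (b : ℝ → ℝ) : E →L[𝕜] E :=
  letI : NormedSpace ℝ (E →L[𝕜] E) := NormedSpace.restrictScalars ℝ 𝕜 (E →L[𝕜] E)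
  ∫ t in (0 : ℝ)..T, ((b t : ℝ) : 𝕜) • opExp A t

/-- `Φ_T = a e^{TA} + ∫₀ᵀ b(t) e^{tA} dt`. -/
def Phi (A : E →ₗ.[𝕜] E) (T a : ℝ) (b : ℝ → ℝ) : E →L[𝕜] E :=
  (a : 𝕜) • opExp A T + averagedSemigroup A T b

/-- The set `b e^{T σ(A)}`. -/
def scaledExpSpectrum (A : E →ₗ.[𝕜] E) (T b : ℝ) : Set 𝕜 :=
  (fun z : 𝕜 => (b : 𝕜) * NormedSpace.exp ((T : 𝕜) * z)) '' spectrum A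

/-- The point spectrum (set of eigenvalues) of a bounded operator. -/
def pointSpectrum (B : E →L[𝕜] E) : Set 𝕜 :=
  {z | Module.End.HasEigenvalue (B : E →ₗ[𝕜] E) z}

end NonlocalEvolution

end

namespace NonlocalEvolution

variable {𝕜 E ι : Type*} [RCLike 𝕜] [NormedAddCommGroup E] [InnerProductSpace 𝕜 E]

/-! ### Coordinates with respect to a Hilbert basis -/

/-! Everything is diagonal in one Hilbert basis. Eigenvalues of `A` are at most `α`, so `α + 1 - A`
is injective and, by the Fredholm alternative, has a compact symmetric inverse `R`. An eigenbasis of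
`R` turns `A` into multiplication by real numbers `λ_i → -∞` on its maximal domain
(`exists_isDiagonalizedBy`).

Since `λ_i ≤ α`, the multipliers `e^{tλ_i}` define a semigroup generated by `A`. As `opExp` is an
arbitrary choice among semigroups generated by `A`, it must also be shown that any such semigroup
has these multipliers (`IsC0Semigroup.isDiagonalSemigroup`). Integration then gives the multipliers
`∫ b(t) e^{λ_i t} dt` and, for `Phi`, `e^{Tλ_i} (a + ∫ b(t) e^{-λ_i (T-t)} dt)`.

The eigenvalues of a diagonal operator are exactly its multipliers, and `σ(A)` is exactly the set of
the `λ_i`, so each criterion can be read off index by index. Any enumeration with multiplicity has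
the same range as `λ` (`IsDiagonalizedBy.range_eq_of_enumeration`), which carries the criteria over
to it. -/

theorem hasSum_norm_inner_sq (e : HilbertBasis ι 𝕜 E) (x : E) :
    HasSum (fun i => ‖inner 𝕜 (e i) x‖ ^ 2) (‖x‖ ^ 2) := by
  have h := RCLike.hasSum_re 𝕜 (e.hasSum_inner_mul_inner x x)
  rw [inner_self_eq_norm_sq] at h
  refine h.congr_fun fun i => ?_
  rw [← inner_conj_symm x (e i), RCLike.conj_mul]
  norm_cast

theorem ext_inner_basis (e : HilbertBasis ι 𝕜 E) {x y : E}
    (h : ∀ i, inner 𝕜 (e i) x = inner 𝕜 (e i) y) : x = y := by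
  apply e.repr.injective
  ext i
  rw [e.repr_apply_apply, e.repr_apply_apply, h]

theorem exists_inner_basis_eq (e : HilbertBasis ι 𝕜 E) {c : ι → 𝕜}
    (hc : Summable fun i => ‖c i‖ ^ 2) : ∃ y : E, ∀ i, inner 𝕜 (e i) y = c i := by
  have hmem : Memℓp c 2 := by
    apply memℓp_gen
    simpa using hc
  refine ⟨e.repr.symm ⟨c, hmem⟩, fun i => ?_⟩
  rw [← e.repr_apply_apply]
  simp

theorem norm_le_of_norm_inner_basis_le (e : HilbertBasis ι 𝕜 E) {x y : E} {C : ℝ} (hC : 0 ≤ C)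
    (h : ∀ i, ‖inner 𝕜 (e i) y‖ ≤ C * ‖inner 𝕜 (e i) x‖) : ‖y‖ ≤ C * ‖x‖ := by
  have hy := hasSum_norm_inner_sq e y
  have hx := (hasSum_norm_inner_sq e x).mul_left (C ^ 2)
  have := hasSum_le (fun i => by
    have := pow_le_pow_left₀ (norm_nonneg _) (h i) 2
    rwa [mul_pow] at this) hy hx
  rw [← mul_pow] at this
  exact le_of_sq_le_sq this (by positivity)

/-- A bounded family of scalars defines a bounded diagonal operator. -/
theorem exists_diagonal (e : HilbertBasis ι 𝕜 E) {m : ι → 𝕜} {C : ℝ}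
    (hm : ∀ i, ‖m i‖ ≤ C) :
    ∃ D : E →L[𝕜] E, ∀ x i, inner 𝕜 (e i) (D x) = m i * inner 𝕜 (e i) x := by
  have hle : ∀ x i, ‖m i * inner 𝕜 (e i) x‖ ≤ max C 0 * ‖inner 𝕜 (e i) x‖ := fun x i => by
    rw [norm_mul]
    gcongr
    exact (hm i).trans (le_max_left _ _)
  have hex : ∀ x : E, ∃ y : E, ∀ i, inner 𝕜 (e i) y = m i * inner 𝕜 (e i) x := fun x => by
    apply exists_inner_basis_eq
    refine Summable.of_nonneg_of_le (fun i => by positivity) (fun i => ?_)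
      ((hasSum_norm_inner_sq e x).summable.mul_left (max C 0 ^ 2))
    rw [← mul_pow]
    exact pow_le_pow_left₀ (norm_nonneg _) (hle x i) 2
  choose f hf using hex
  let F : E →ₗ[𝕜] E :=
    { toFun := f
      map_add' := fun x y => ext_inner_basis e fun i => by
        simp only [hf, inner_add_right, mul_add]
      map_smul' := fun c x => ext_inner_basis e fun i => by
        simp only [hf, inner_smul_right, RingHom.id_apply]
        ring }
  exact ⟨F.mkContinuous (max C 0) fun x => norm_le_of_norm_inner_basis_le e (le_max_right _ _)
    fun i => by simpa only [F, LinearMap.coe_mk, AddHom.coe_mk, hf] using hle x i, hf⟩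

theorem opNorm_le_of_diagonal (e : HilbertBasis ι 𝕜 E) {m : ι → 𝕜} {D : E →L[𝕜] E}
    (hD : ∀ x i, inner 𝕜 (e i) (D x) = m i * inner 𝕜 (e i) x) {C : ℝ} (hC : 0 ≤ C)
    (hm : ∀ i, ‖m i‖ ≤ C) : ‖D‖ ≤ C :=
  D.opNorm_le_bound hC fun x => norm_le_of_norm_inner_basis_le e hC fun i => by
    rw [hD, norm_mul]
    gcongr
    exact hm i

/-- Dominated convergence in coordinates. -/
theorem tendsto_of_tendsto_inner_basis {β : Type*} {l : Filter β} (e : HilbertBasis ι 𝕜 E)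
    {f : β → E} {y z : E} {C : ℝ}
    (hlim : ∀ i, Tendsto (fun n => inner 𝕜 (e i) (f n)) l (𝓝 (inner 𝕜 (e i) y)))
    (hbound : ∀ᶠ n in l, ∀ i, ‖inner 𝕜 (e i) (f n - y)‖ ≤ C * ‖inner 𝕜 (e i) z‖) :
    Tendsto f l (𝓝 y) := by
  have hsum : Tendsto (fun n => ∑' i, ‖inner 𝕜 (e i) (f n - y)‖ ^ 2) l
      (𝓝 (∑' _ : ι, (0 : ℝ))) := by
    refine tendsto_tsum_of_dominated_convergence
      ((hasSum_norm_inner_sq e z).summable.mul_left (C ^ 2)) (fun i => ?_) ?_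
    · have : Tendsto (fun n => inner 𝕜 (e i) (f n - y)) l (𝓝 0) := by
        simpa [inner_sub_right] using (hlim i).sub_const (inner 𝕜 (e i) y)
      simpa using this.norm.pow 2
    · filter_upwards [hbound] with n hn i
      rw [← mul_pow, Real.norm_of_nonneg (by positivity)]
      exact pow_le_pow_left₀ (norm_nonneg _) (hn i) 2
  simp only [(hasSum_norm_inner_sq e _).tsum_eq, tsum_zero] at hsum
  rw [tendsto_iff_norm_sub_tendsto_zero]
  have := (Real.continuous_sqrt.tendsto 0).comp hsum
  simpa [Function.comp_def, Real.sqrt_sq (norm_nonneg _)] using this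

/-! ### Diagonalization of operators with compact resolvent -/

theorem IsResolventAt.mem_graph {A : E →ₗ.[𝕜] E} {z : 𝕜} {R : E →L[𝕜] E}
    (hR : IsResolventAt A z R) (y : E) : (R y, z • R y - y) ∈ A.graph := by
  obtain ⟨h, hy⟩ := hR.1 y
  rw [LinearPMap.mem_graph_iff]
  exact ⟨⟨R y, h⟩, rfl, (sub_eq_iff_eq_add.2 (sub_eq_iff_eq_add'.1 hy)).symm⟩

theorem IsResolventAt.apply_of_mem_graph {A : E →ₗ.[𝕜] E} {z : 𝕜} {R : E →L[𝕜] E}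
    (hR : IsResolventAt A z R) {x y : E} (h : (x, y) ∈ A.graph) : R (z • x - y) = x := by
  rw [LinearPMap.mem_graph_iff] at h
  obtain ⟨x', rfl, rfl⟩ := h
  exact hR.2 x'

theorem isResolventAt_of_graph {A : E →ₗ.[𝕜] E} {z : 𝕜} {R : E →L[𝕜] E}
    (h₁ : ∀ y, (R y, z • R y - y) ∈ A.graph)
    (h₂ : ∀ x y, (x, y) ∈ A.graph → R (z • x - y) = x) : IsResolventAt A z R := by
  refine ⟨fun y => ?_, fun x => h₂ _ _ (A.mem_graph x)⟩
  obtain ⟨x, hx, hy⟩ := (LinearPMap.mem_graph_iff A).1 (h₁ y)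
  have h : R y ∈ A.domain := by
    simp only at hx
    exact hx ▸ x.2
  refine ⟨h, ?_⟩
  have : x = ⟨R y, h⟩ := Subtype.ext hx
  rw [← this, hy]
  simp

/-- If some resolvent is compact and `w - A` is injective, then `w` belongs to the resolvent set
and the resolvent at `w` is compact. -/
theorem HasCompactResolvent.exists_isResolventAt [CompleteSpace E] {A : E →ₗ.[𝕜] E}
    (hA : HasCompactResolvent A) {w : 𝕜} (hw : ∀ x : E, (x, w • x) ∈ A.graph → x = 0) :
    ∃ R : E →L[𝕜] E, IsResolventAt A w R ∧ IsCompactOperator R := by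
  obtain ⟨z, R, hR, hcomp⟩ := hA
  rcases eq_or_ne w z with rfl | hne
  · exact ⟨R, hR, hcomp⟩
  have hzw : z - w ≠ 0 := sub_ne_zero.2 hne.symm
  -- An eigenvector of `R` for `(z - w)⁻¹` would be an eigenvector of `A` for `w`.
  have hnot : ¬ Module.End.HasEigenvalue (R : Module.End 𝕜 E) (z - w)⁻¹ := by
    intro h
    obtain ⟨v, hv⟩ := h.exists_hasEigenvector
    have hRv : R v = (z - w)⁻¹ • v := hv.apply_eq_smul
    apply hv.2
    apply hw
    have hg := A.graph.smul_mem (z - w) (hR.mem_graph v)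
    rw [hRv] at hg
    convert hg using 1
    ext
    · simp [smul_smul, hzw]
    · simp only [Prod.smul_mk, smul_sub, smul_smul]
      rw [mul_left_comm, mul_inv_cancel₀ hzw, mul_one, ← sub_smul, sub_sub_cancel]
  have hres := (hcomp.hasEigenvalue_or_mem_resolventSet (inv_ne_zero hzw)).resolve_left hnot
  rw [_root_.spectrum.mem_resolventSet_iff] at hres
  obtain ⟨u, hu⟩ := hres
  have huv : ∀ y, (z - w) • (u : E →L[𝕜] E) y = y - (z - w) • R y := fun y => by
    rw [hu]
    simp [Algebra.algebraMap_eq_smul_one, smul_sub, smul_smul, hzw]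
  -- `V` inverts `1 - (z - w) R`. Since `w - A = (1 - (z - w) R)(z - A)`, the resolvent at `w` is `R
  -- V`.
  let V : E →L[𝕜] E := (z - w)⁻¹ • (↑u⁻¹ : E →L[𝕜] E)
  have hUV : ∀ y, V y - (z - w) • R (V y) = y := fun y => by
    rw [← huv]
    have : (u : E →L[𝕜] E) ((↑u⁻¹ : E →L[𝕜] E) y) = y := by
      rw [← mul_apply_eq_comp, Units.mul_inv, one_apply_eq_self]
    simp [V, smul_smul, hzw, this]
  have hVU : ∀ y, V (y - (z - w) • R y) = y := fun y => by
    rw [← huv]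
    have : (↑u⁻¹ : E →L[𝕜] E) ((u : E →L[𝕜] E) y) = y := by
      rw [← mul_apply_eq_comp, Units.inv_mul, one_apply_eq_self]
    simp [V, smul_smul, hzw, this]
  refine ⟨R.comp V, isResolventAt_of_graph (fun y => ?_) fun x y hxy => ?_, hcomp.comp_clm V⟩
  · convert hR.mem_graph (V y) using 1
    ext
    · rfl
    · change w • R (V y) - y = z • R (V y) - V y
      nth_rw 2 [← hUV y]
      rw [sub_smul]
      abel
  · have h := hR.apply_of_mem_graph hxy
    have h2 := hVU (z • x - y)
    rw [h] at h2
    have h3 : z • x - y - (z - w) • x = w • x - y := by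
      rw [sub_smul]
      abel
    rw [h3] at h2
    rw [ContinuousLinearMap.comp_apply, h2, h]

theorem inner_graph_symm [CompleteSpace E] {A : E →ₗ.[𝕜] E} (hA : IsSelfAdjoint A)
    {x y x' y' : E} (h : (x, y) ∈ A.graph) (h' : (x', y') ∈ A.graph) :
    inner 𝕜 y x' = inner 𝕜 x y' := by
  have hsym : A.IsFormalAdjoint A := by
    have := LinearPMap.adjoint_isFormalAdjoint hA.dense_domain
    rwa [LinearPMap.isSelfAdjoint_def.1 hA] at this
  rw [LinearPMap.mem_graph_iff] at h h'
  obtain ⟨u, rfl, rfl⟩ := h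
  obtain ⟨v, rfl, rfl⟩ := h'
  exact hsym u v

theorem BoundedAboveBy.le_of_mem_graph {A : E →ₗ.[𝕜] E} {α : ℝ} (hα : BoundedAboveBy A α)
    {x : E} {μ : ℝ} (hx : x ≠ 0) (h : (x, (μ : 𝕜) • x) ∈ A.graph) : μ ≤ α := by
  rw [LinearPMap.mem_graph_iff] at h
  obtain ⟨u, hu, hAu⟩ := h
  have := hα u
  simp only at hu hAu
  rw [hAu, hu, inner_smul_left, RCLike.conj_ofReal, RCLike.re_ofReal_mul,
    inner_self_eq_norm_sq] at this
  exact le_of_mul_le_mul_right this (by positivity)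

/-- A compact self-adjoint operator has a Hilbert basis of eigenvectors. -/
theorem exists_hilbertBasis_eigenvectors.{u, v} {𝕜 : Type u} {E : Type v} [RCLike 𝕜]
    [NormedAddCommGroup E] [InnerProductSpace 𝕜 E] [CompleteSpace E] {R : E →L[𝕜] E}
    (hcomp : IsCompactOperator R) (hsym : (R : E →ₗ[𝕜] E).IsSymmetric) :
    ∃ (ι : Type (max u v)) (e : HilbertBasis ι 𝕜 E) (μ : ι → 𝕜), ∀ i, R (e i) = μ i • e i := by
  have hclosed : ∀ μ, IsClosed (Module.End.eigenspace (R : E →ₗ[𝕜] E) μ : Set E) := fun μ => by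
    have : (Module.End.eigenspace (R : E →ₗ[𝕜] E) μ : Set E) = {x | R x = μ • x} := by
      ext x
      simp
    rw [this]
    exact isClosed_eq R.continuous (continuous_const_smul μ)
  have hcompl : ∀ μ, CompleteSpace (Module.End.eigenspace (R : E →ₗ[𝕜] E) μ) :=
    fun μ => (hclosed μ).completeSpace_coe
  choose w b _ using fun μ => exists_hilbertBasis 𝕜 (Module.End.eigenspace (R : E →ₗ[𝕜] E) μ)
  have hon := hsym.orthogonalFamily_eigenspaces.orthonormal_sigma_orthonormal
    (v_family := fun μ => b μ) fun μ => (b μ).orthonormal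
  refine ⟨Σ μ, w μ, HilbertBasis.mkOfOrthogonalEqBot hon ?_, fun i => i.1, fun i => ?_⟩
  -- The eigenspace for `0` is included. A vector orthogonal to the chosen bases is orthogonal to
  -- every eigenspace, hence zero by the spectral theorem.
  · rw [eq_bot_iff, ← ContinuousLinearMap.orthogonalComplement_iSup_eigenspaces_eq_bot hcomp hsym]
    intro x hx
    rw [Submodule.mem_orthogonal'] at hx
    rw [← Submodule.iInf_orthogonal, Submodule.mem_iInf]
    intro μ
    rw [Submodule.mem_orthogonal']
    intro y hy
    have h1 := ((b μ).hasSum_repr ⟨y, hy⟩).mapL (Submodule.subtypeL _)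
    have h2 := h1.mapL (innerSL 𝕜 x)
    refine h2.unique (hasSum_zero.congr_fun fun i => ?_)
    have : inner 𝕜 x (b μ i : E) = 0 := hx _ (Submodule.subset_span ⟨⟨μ, i⟩, rfl⟩)
    simp [this]
  · rw [HilbertBasis.coe_mkOfOrthogonalEqBot]
    exact Module.End.mem_eigenspace_iff.1 (b i.1 i.2).2

/-- The eigenvalues of a compact operator belonging to an orthonormal family of eigenvectors tend
to zero. -/
theorem finite_le_norm_eigenvalue {R : E →L[𝕜] E} (hcomp : IsCompactOperator R) {v : ι → E}
    (hv : Orthonormal 𝕜 v) {μ : ι → 𝕜} (hμ : ∀ i, R (v i) = μ i • v i) {ε : ℝ} (hε : 0 < ε) :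
    {i | ε ≤ ‖μ i‖}.Finite := by
  by_contra hinf
  obtain ⟨K, hK, hKsub⟩ := hcomp.image_closedBall_subset_compact (𝕜₁ := 𝕜) 1
  let g : ℕ ↪ {i | ε ≤ ‖μ i‖} := Set.Infinite.natEmbedding _ hinf
  obtain ⟨y, _, φ, hφ, hlim⟩ := hK.tendsto_subseq (x := fun n => R (v (g n)))
    fun n => hKsub ⟨_, by simp [hv.norm_eq_one], rfl⟩
  have hcauchy := hlim.cauchySeq
  rw [Metric.cauchySeq_iff'] at hcauchy
  obtain ⟨N, hN⟩ := hcauchy ε hε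
  have h := hN (N + 1) (Nat.le_succ N)
  set i := (g (φ (N + 1)) : ι)
  set j := (g (φ N) : ι)
  have hij : i ≠ j := fun hij => by
    have := hφ.injective (g.injective (Subtype.ext hij))
    omega
  have horth : inner 𝕜 (v i) (v j) = 0 := hv.2 hij
  simp only [Function.comp_apply, dist_eq_norm] at h
  rw [hμ, hμ] at h
  -- Pairing with `v i` keeps the images `ε`-separated, so no subsequence can be Cauchy.
  have hle : ‖μ i‖ ≤ ‖μ i • v i - μ j • v j‖ := by
    have := norm_inner_le_norm (𝕜 := 𝕜) (v i) (μ i • v i - μ j • v j)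
    rw [inner_sub_right, inner_smul_right, inner_smul_right, horth,
      inner_self_eq_norm_sq_to_K, hv.norm_eq_one] at this
    simpa using this
  have hmem : ε ≤ ‖μ i‖ := (g (φ (N + 1))).2
  linarith

/-- `A` acts as multiplication by `lam` in the coordinates given by `e`, with maximal domain. -/
def IsDiagonalizedBy (A : E →ₗ.[𝕜] E) (e : HilbertBasis ι 𝕜 E) (lam : ι → ℝ) : Prop :=
  ∀ x y : E, (x, y) ∈ A.graph ↔ ∀ i, inner 𝕜 (e i) y = (lam i : 𝕜) * inner 𝕜 (e i) x

theorem IsDiagonalizedBy.basis_mem_graph {A : E →ₗ.[𝕜] E} {e : HilbertBasis ι 𝕜 E} {lam : ι → ℝ}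
    (h : IsDiagonalizedBy A e lam) (i : ι) : (e i, (lam i : 𝕜) • e i) ∈ A.graph := by
  refine (h _ _).2 fun j => ?_
  rw [inner_smul_right]
  rcases eq_or_ne j i with rfl | hne
  · rfl
  · rw [e.orthonormal.2 hne]
    simp

theorem exists_isDiagonalizedBy.{u, v} {𝕜 : Type u} {E : Type v} [RCLike 𝕜]
    [NormedAddCommGroup E] [InnerProductSpace 𝕜 E] [CompleteSpace E] {A : E →ₗ.[𝕜] E}
    (hA : IsSelfAdjoint A) {α : ℝ} (hα : BoundedAboveBy A α) (hcomp : HasCompactResolvent A) :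
    ∃ (ι : Type (max u v)) (e : HilbertBasis ι 𝕜 E) (lam : ι → ℝ), IsDiagonalizedBy A e lam ∧
      Tendsto lam cofinite atBot ∧ ∀ i, lam i ≤ α := by
  obtain ⟨R, hR, hRc⟩ := hcomp.exists_isResolventAt (w := ((α + 1 : ℝ) : 𝕜)) fun x hx => by
    by_contra hne
    have := hα.le_of_mem_graph hne hx
    linarith
  set c : ℝ := α + 1
  have hsym : (R : E →ₗ[𝕜] E).IsSymmetric := fun x y => by
    have h := inner_graph_symm hA (hR.mem_graph x) (hR.mem_graph y)
    rw [inner_sub_left, inner_sub_right, inner_smul_left, inner_smul_right,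
      RCLike.conj_ofReal] at h
    exact (sub_right_injective h).symm
  obtain ⟨ι, e, μ, hμ⟩ := exists_hilbertBasis_eigenvectors hRc hsym
  have he0 : ∀ i, e i ≠ 0 := fun i => e.orthonormal.ne_zero i
  -- If `R (e i) = 0`, the graph of `A` would contain `(0, -e i)`.
  have hμ0 : ∀ i, μ i ≠ 0 := fun i h0 => by
    have h := hR.mem_graph (e i)
    rw [hμ, h0, zero_smul, smul_zero, zero_sub] at h
    have := LinearPMap.graph_fst_eq_zero_snd A h rfl
    exact he0 i (neg_eq_zero.1 this)
  have hμreal : ∀ i, ((RCLike.re (μ i) : ℝ) : 𝕜) = μ i := fun i => by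
    rw [← RCLike.conj_eq_iff_re]
    refine hsym.conj_eigenvalue_eq_self
      (Module.End.hasEigenvalue_of_hasEigenvector (x := e i) ⟨?_, he0 i⟩)
    exact Module.End.mem_eigenspace_iff.2 (hμ i)
  let lam : ι → ℝ := fun i => c - (RCLike.re (μ i))⁻¹
  have hlam : ∀ i, (lam i : 𝕜) = c - (μ i)⁻¹ := fun i => by
    simp only [lam]
    rw [RCLike.ofReal_sub, RCLike.ofReal_inv, hμreal]
  have hRcoord : ∀ y i, inner 𝕜 (e i) (R y) = μ i * inner 𝕜 (e i) y := fun y i => by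
    have := hsym (e i) y
    simp only [ContinuousLinearMap.coe_coe] at this
    rw [← this, hμ, inner_smul_left, ← hμreal, RCLike.conj_ofReal]
  have hdiag : IsDiagonalizedBy A e lam := by
    intro x y
    constructor
    · intro h i
      have := hRcoord (((c : ℝ) : 𝕜) • x - y) i
      rw [hR.apply_of_mem_graph h, inner_sub_right, inner_smul_right] at this
      rw [hlam]
      rw [← inv_mul_eq_iff_eq_mul₀ (hμ0 i)] at this
      linear_combination this
    · intro h
      -- This gives maximality of the domain: the coordinate relations alone force `x` into the
      -- range of `R`.
      have hx : R (((c : ℝ) : 𝕜) • x - y) = x := ext_inner_basis e fun i => by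
        rw [hRcoord, inner_sub_right, inner_smul_right, h, hlam]
        have h0 := hμ0 i
        field_simp
        ring
      have := hR.mem_graph (((c : ℝ) : 𝕜) • x - y)
      rwa [hx, sub_sub_cancel] at this
  have hle : ∀ i, lam i ≤ α := fun i => hα.le_of_mem_graph (he0 i) (hdiag.basis_mem_graph i)
  refine ⟨ι, e, lam, hdiag, ?_, hle⟩
  rw [tendsto_atBot]
  intro r
  -- An eigenvalue above `r` has `1 ≤ μ⁻¹ < c - r`, so `μ` stays above this threshold, which only
  -- finitely many `μ i` reach.
  have hpos : 0 < (|c - r| + 1)⁻¹ := by positivity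
  refine (finite_le_norm_eigenvalue hRc e.orthonormal hμ hpos).subset fun i hi => ?_
  simp only [mem_compl_iff, mem_ofPred_eq, not_le] at hi ⊢
  have h1 : (RCLike.re (μ i))⁻¹ < c - r := by
    simp only [lam] at hi
    linarith
  have h2 : 1 ≤ (RCLike.re (μ i))⁻¹ := by
    have := hle i
    simp only [lam] at this
    linarith
  have h3 : 0 < RCLike.re (μ i) := inv_pos.1 (by linarith)
  rw [← hμreal, RCLike.norm_ofReal, abs_of_pos h3, inv_le_comm₀ (by positivity) h3]
  linarith [le_abs_self (c - r)]

section Semigroup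

/-! ### The semigroup generated by a diagonal operator -/

/-- `S t` acts as multiplication by `e^{t λ_i}` in the coordinates given by `e`, for `t ≥ 0`. -/
def IsDiagonalSemigroup (S : ℝ → E →L[𝕜] E) (e : HilbertBasis ι 𝕜 E) (lam : ι → ℝ) : Prop :=
  ∀ t : ℝ, 0 ≤ t → ∀ x i,
    inner 𝕜 (e i) (S t x) = ((Real.exp (t * lam i) : ℝ) : 𝕜) * inner 𝕜 (e i) x

theorem exists_isDiagonalSemigroup (e : HilbertBasis ι 𝕜 E) {lam : ι → ℝ} {α : ℝ}
    (hlam : ∀ i, lam i ≤ α) : ∃ S : ℝ → E →L[𝕜] E, IsDiagonalSemigroup S e lam := by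
  have : ∀ t : ℝ, ∃ D : E →L[𝕜] E, 0 ≤ t → ∀ x i,
      inner 𝕜 (e i) (D x) = ((Real.exp (t * lam i) : ℝ) : 𝕜) * inner 𝕜 (e i) x := fun t => by
    by_cases ht : 0 ≤ t
    · obtain ⟨D, hD⟩ := exists_diagonal e (m := fun i => ((Real.exp (t * lam i) : ℝ) : 𝕜))
        (C := Real.exp (t * α)) fun i => by
          rw [RCLike.norm_ofReal, Real.abs_exp]
          gcongr
          exact hlam i
      exact ⟨D, fun _ => hD⟩
    -- At negative times the multipliers may be unbounded, so a junk value is used.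
    · exact ⟨0, fun h => absurd h ht⟩
  choose S hS using this
  exact ⟨S, hS⟩

variable {A : E →ₗ.[𝕜] E} {S : ℝ → E →L[𝕜] E} {e : HilbertBasis ι 𝕜 E} {lam : ι → ℝ} {α : ℝ}

theorem mul_le_mul_abs_of_le {t r l a : ℝ} (ht : 0 ≤ t) (htr : t ≤ r) (hl : l ≤ a) :
    t * l ≤ r * |a| := by
  have h1 : t * l ≤ t * |a| := mul_le_mul_of_nonneg_left (hl.trans (le_abs_self a)) ht
  exact h1.trans (mul_le_mul_of_nonneg_right htr (abs_nonneg a))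

theorem IsDiagonalSemigroup.isC0Semigroup (hS : IsDiagonalSemigroup S e lam)
    (hlam : ∀ i, lam i ≤ α) : IsC0Semigroup S where
  zero := by
    ext x
    refine ext_inner_basis e fun i => ?_
    rw [hS 0 le_rfl]
    simp
  add s t hs ht := by
    ext x
    refine ext_inner_basis e fun i => ?_
    rw [mul_apply_eq_comp, hS _ (add_nonneg hs ht), hS s hs, hS t ht, add_mul, Real.exp_add,
      RCLike.ofReal_mul, mul_assoc]
  continuousOn x := by
    intro t ht
    have ht0 : 0 ≤ t := ht
    have hev : ∀ᶠ s in 𝓝[Ici 0] t, 0 ≤ s ∧ s ≤ t + 1 :=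
      (eventually_mem_nhdsWithin).and
        (mem_nhdsWithin_of_mem_nhds (Iic_mem_nhds (by linarith)))
    refine tendsto_of_tendsto_inner_basis e (z := x) (C := 2 * Real.exp ((t + 1) * |α|))
      (fun i => ?_) ?_
    · rw [hS t ht0]
      have hc : Tendsto (fun s : ℝ => ((Real.exp (s * lam i) : ℝ) : 𝕜) * inner 𝕜 (e i) x)
          (𝓝[Ici 0] t) (𝓝 (((Real.exp (t * lam i) : ℝ) : 𝕜) * inner 𝕜 (e i) x)) := by
        refine Tendsto.mono_left (Continuous.tendsto ?_ t) nhdsWithin_le_nhds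
        have : Continuous fun s : ℝ => Real.exp (s * lam i) := by fun_prop
        exact (RCLike.continuous_ofReal.comp this).mul continuous_const
      refine hc.congr' ?_
      filter_upwards [hev] with s hs
      rw [hS s hs.1]
    · filter_upwards [hev] with s hs i
      rw [inner_sub_right, hS s hs.1, hS t ht0, ← sub_mul, norm_mul]
      gcongr
      refine (norm_sub_le _ _).trans ?_
      rw [RCLike.norm_ofReal, RCLike.norm_ofReal, Real.abs_exp, Real.abs_exp, two_mul]
      exact add_le_add
        (Real.exp_le_exp.2 (mul_le_mul_abs_of_le hs.1 hs.2 (hlam i)))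
        (Real.exp_le_exp.2 (mul_le_mul_abs_of_le ht0 (by linarith) (hlam i)))

/-- Dominates the difference quotients of the semigroup: with `u = hλ` and `v = |α|`, they are at
most `|λ| e^{|α|}` for `0 < h ≤ 1`, uniformly although `λ` is unbounded below. -/
theorem abs_exp_sub_one_le {u v : ℝ} (huv : u ≤ v) (hv : 0 ≤ v) :
    |Real.exp u - 1| ≤ |u| * Real.exp v := by
  have hv1 : 1 ≤ Real.exp v := Real.one_le_exp hv
  rcases le_total 0 u with hu | hu
  · rw [abs_of_nonneg hu, abs_of_nonneg (by linarith [Real.one_le_exp hu])]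
    have h1 : Real.exp u - 1 ≤ u * Real.exp u := by
      have h2 := mul_le_mul_of_nonneg_right (Real.add_one_le_exp (-u)) (Real.exp_pos u).le
      rw [← Real.exp_add, neg_add_cancel, Real.exp_zero] at h2
      linarith
    exact h1.trans (mul_le_mul_of_nonneg_left (Real.exp_le_exp.2 huv) hu)
  · rw [abs_of_nonpos hu, abs_of_nonpos (by linarith [Real.exp_le_one_iff.2 hu])]
    have h1 := Real.add_one_le_exp u
    have h2 : -u * 1 ≤ -u * Real.exp v := mul_le_mul_of_nonneg_left hv1 (by linarith)
    linarith

theorem tendsto_inv_mul_exp_sub_one (l : ℝ) :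
    Tendsto (fun h : ℝ => h⁻¹ * (Real.exp (h * l) - 1)) (𝓝[>] 0) (𝓝 l) := by
  have hd : HasDerivAt (fun h : ℝ => Real.exp (h * l)) l 0 := by
    simpa using ((hasDerivAt_id (0 : ℝ)).mul_const l).exp
  have := (hasDerivAt_iff_tendsto_slope_zero.1 hd).mono_left
    (nhdsWithin_mono 0 fun x (hx : x ∈ Ioi (0 : ℝ)) => (mem_Ioi.1 hx).ne')
  simpa using this

theorem IsDiagonalSemigroup.isGenerator (hS : IsDiagonalSemigroup S e lam)
    (hA : IsDiagonalizedBy A e lam) (hlam : ∀ i, lam i ≤ α) : IsGenerator A S := by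
  have hcoord : ∀ (x : E) (i : ι) (h : ℝ), 0 < h →
      inner 𝕜 (e i) (((h⁻¹ : ℝ) : 𝕜) • (S h x - x)) =
        ((h⁻¹ * (Real.exp (h * lam i) - 1) : ℝ) : 𝕜) * inner 𝕜 (e i) x := fun x i h hh => by
    rw [inner_smul_right, inner_sub_right, hS h hh.le, RCLike.ofReal_mul, RCLike.ofReal_sub,
      RCLike.ofReal_one]
    ring
  have hlim : ∀ (x : E) (i : ι),
      Tendsto (fun h : ℝ => inner 𝕜 (e i) (((h⁻¹ : ℝ) : 𝕜) • (S h x - x))) (𝓝[>] 0)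
        (𝓝 ((lam i : 𝕜) * inner 𝕜 (e i) x)) := fun x i => by
    have h1 := ((RCLike.continuous_ofReal (K := 𝕜)).tendsto (lam i)).comp
      (tendsto_inv_mul_exp_sub_one (lam i))
    refine (h1.mul_const (inner 𝕜 (e i) x)).congr' ?_
    filter_upwards [self_mem_nhdsWithin] with h hh
    rw [hcoord x i h hh]
    rfl
  intro x y
  constructor
  · intro hxy
    rw [hA] at hxy
    -- The dominating vector is `y = A x`, not `x`: its coordinates already carry the factor `λ_i`.
    refine tendsto_of_tendsto_inner_basis e (z := y) (C := Real.exp |α| + 1)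
      (fun i => by rw [hxy]; exact hlim x i) ?_
    filter_upwards [Ioc_mem_nhdsGT (zero_lt_one' ℝ)] with h hh i
    have hh0 : 0 < h := hh.1
    rw [inner_sub_right, hcoord x i h hh0, hxy, ← sub_mul, norm_mul, norm_mul, ← mul_assoc]
    gcongr
    refine (norm_sub_le _ _).trans ?_
    rw [RCLike.norm_ofReal, RCLike.norm_ofReal, add_mul, one_mul]
    gcongr
    rw [abs_mul, abs_of_pos (inv_pos.2 hh0), inv_mul_le_iff₀ hh0]
    have hle : h * lam i ≤ |α| := by
      simpa using mul_le_mul_abs_of_le hh0.le hh.2 (hlam i)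
    refine (abs_exp_sub_one_le hle (abs_nonneg α)).trans (le_of_eq ?_)
    rw [abs_mul, abs_of_pos hh0]
    ring
  · intro h
    -- Maximality of the domain reduces membership in the graph to the coordinatewise limits.
    refine (hA x y).2 fun i => ?_
    have h1 := ((innerSL 𝕜 (e i)).continuous.tendsto y).comp h
    exact tendsto_nhds_unique h1 (hlim x i)

/-- A semigroup is determined on eigenvectors by its generator. -/
theorem IsC0Semigroup.apply_of_mem_graph (hS : IsC0Semigroup S) (hA : IsGenerator A S) {x : E}
    {l : ℝ} (hx : (x, (l : 𝕜) • x) ∈ A.graph) {t : ℝ} (ht : 0 ≤ t) :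
    S t x = ((Real.exp (t * l) : ℝ) : 𝕜) • x := by
  refine ext_inner_left 𝕜 fun w => ?_
  let q : ℝ → 𝕜 := fun s => inner 𝕜 w (S s x)
  -- `g` is constant because its right derivative vanishes; the generator only gives one-sided
  -- derivatives.
  let g : ℝ → 𝕜 := fun s => Real.exp (-(s * l)) • q s
  have hq : ∀ s, 0 ≤ s → HasDerivWithinAt q ((l : 𝕜) * q s) (Ici s) s := fun s hs => by
    rw [← hasDerivWithinAt_Ioi_iff_Ici, hasDerivWithinAt_iff_tendsto_slope' (by simp)]
    have hshift : Tendsto (fun u : ℝ => u - s) (𝓝[>] s) (𝓝[>] 0) := by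
      refine tendsto_nhdsWithin_of_tendsto_nhds_of_eventually_within _ ?_ ?_
      · have : Tendsto (fun u : ℝ => u - s) (𝓝 s) (𝓝 (s - s)) :=
          (continuous_id.sub continuous_const).tendsto s
        rw [sub_self] at this
        exact this.mono_left nhdsWithin_le_nhds
      · filter_upwards [self_mem_nhdsWithin] with u hu
        exact sub_pos.2 (mem_Ioi.1 hu)
    have h1 := ((hA x _).1 hx).comp hshift
    have h2 := (((innerSL 𝕜 w).comp (S s)).continuous.tendsto _).comp h1
    simp only [ContinuousLinearMap.comp_apply, map_smul, innerSL_apply_apply, smul_eq_mul] at h2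
    refine h2.congr' ?_
    filter_upwards [self_mem_nhdsWithin] with u hu
    have hsu : S u x = S s (S (u - s) x) := by
      rw [← mul_apply_eq_comp, ← hS.add s (u - s) hs (sub_pos.2 (mem_Ioi.1 hu)).le, add_sub_cancel]
    simp only [Function.comp_apply, ContinuousLinearMap.comp_apply, map_smul, map_sub,
      innerSL_apply_apply, slope_def_module, q, smul_eq_mul, hsu, RCLike.real_smul_eq_coe_mul]
  have hexp : ∀ s, HasDerivAt (fun s : ℝ => Real.exp (-(s * l))) (Real.exp (-(s * l)) * -l) s :=
    fun s => by simpa using ((hasDerivAt_id s).mul_const l).neg.exp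
  have hg : ∀ s ∈ Icc 0 t, g s = g 0 := by
    refine constant_of_has_deriv_right_zero ?_ fun s hs => ?_
    · refine ContinuousOn.smul (by fun_prop) ?_
      exact (innerSL 𝕜 w).continuous.comp_continuousOn
        ((hS.continuousOn x).mono Icc_subset_Ici_self)
    · refine ((hexp s).hasDerivWithinAt.smul (hq s hs.1)).congr_deriv ?_
      simp only [RCLike.real_smul_eq_coe_mul, RCLike.ofReal_mul, RCLike.ofReal_neg]
      ring
  have := hg t ⟨ht, le_rfl⟩
  simp only [g, q, hS.zero, zero_mul, neg_zero, Real.exp_zero, one_smul, one_apply_eq_self] at this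
  rw [inner_smul_right, ← this, RCLike.real_smul_eq_coe_mul, ← mul_assoc, ← RCLike.ofReal_mul,
    ← Real.exp_add, add_neg_cancel, Real.exp_zero, RCLike.ofReal_one, one_mul]

/-- On each basis vector the semigroup solves a scalar linear equation; density of the span and
boundedness of `S t` do the rest. -/
theorem IsC0Semigroup.isDiagonalSemigroup (hS : IsC0Semigroup S) (hgen : IsGenerator A S)
    (hA : IsDiagonalizedBy A e lam) : IsDiagonalSemigroup S e lam := by
  intro t ht x i
  have hdense : Dense (Submodule.span 𝕜 (range e) : Set E) :=
    Submodule.dense_iff_topologicalClosure_eq_top.2 e.dense_span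
  have heq : (innerSL 𝕜 (e i)).comp (S t) =
      ((Real.exp (t * lam i) : ℝ) : 𝕜) • innerSL 𝕜 (e i) := by
    refine ContinuousLinearMap.ext_on hdense ?_
    rintro _ ⟨j, rfl⟩
    have := hS.apply_of_mem_graph hgen (hA.basis_mem_graph j) ht
    simp only [ContinuousLinearMap.comp_apply, this, map_smul, innerSL_apply_apply,
      smul_apply, smul_eq_mul]
    rcases eq_or_ne i j with rfl | hne
    · rfl
    · rw [e.orthonormal.2 hne, mul_zero, mul_zero]
  simpa using congrArg (fun f => f x) heq

theorem IsDiagonalizedBy.opExp_spec (hA : IsDiagonalizedBy A e lam) (hlam : ∀ i, lam i ≤ α) :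
    IsC0Semigroup (opExp A) ∧ IsGenerator A (opExp A) := by
  have h : ∃ S : ℝ → E →L[𝕜] E, IsC0Semigroup S ∧ IsGenerator A S := by
    obtain ⟨S, hS⟩ := exists_isDiagonalSemigroup e hlam
    exact ⟨S, hS.isC0Semigroup hlam, hS.isGenerator hA hlam⟩
  rw [opExp, dif_pos h]
  exact h.choose_spec

theorem IsDiagonalizedBy.opExp_diagonal (hA : IsDiagonalizedBy A e lam)
    (hlam : ∀ i, lam i ≤ α) : IsDiagonalSemigroup (opExp A) e lam :=
  (hA.opExp_spec hlam).1.isDiagonalSemigroup (hA.opExp_spec hlam).2 hA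

/-! ### Integrals of the semigroup -/

/-- Bounds the time derivative of `e^{rλ}` uniformly in `λ ≤ a` for `r` in `[δ, ρ]`. For negative
`λ` this is `x e^{-δx} ≤ δ⁻¹`, so times near zero must be excluded. -/
theorem abs_mul_exp_le {r δ ρ l a : ℝ} (hδ : 0 < δ) (hδr : δ ≤ r) (hrρ : r ≤ ρ) (hl : l ≤ a) :
    |l| * Real.exp (r * l) ≤ δ⁻¹ + |a| * Real.exp (ρ * |a|) := by
  have hr : 0 < r := hδ.trans_le hδr
  rcases le_total 0 l with h | h
  · have h1 : |l| * Real.exp (r * l) ≤ |a| * Real.exp (ρ * |a|) := by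
      gcongr ?_ * Real.exp ?_
      · exact abs_le_abs_of_nonneg h hl
      · exact mul_le_mul_abs_of_le hr.le hrρ hl
    have : 0 < δ⁻¹ := inv_pos.2 hδ
    linarith
  · have h1 : |l| * Real.exp (r * l) ≤ δ⁻¹ := by
      rw [abs_of_nonpos h, ← one_div, le_div_iff₀ hδ]
      have h2 := Real.add_one_le_exp (-(r * l))
      have h3 : -l * δ ≤ Real.exp (-(r * l)) := by nlinarith
      calc -l * Real.exp (r * l) * δ = -l * δ * Real.exp (r * l) := by ring
        _ ≤ Real.exp (-(r * l)) * Real.exp (r * l) := by gcongr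
        _ = 1 := by rw [← Real.exp_add, neg_add_cancel, Real.exp_zero]
    have : 0 ≤ |a| * Real.exp (ρ * |a|) := by positivity
    linarith

/-- A diagonal semigroup is continuous in operator norm at positive times. -/
theorem IsDiagonalSemigroup.continuousOn_Ioi (hS : IsDiagonalSemigroup S e lam)
    (hlam : ∀ i, lam i ≤ α) : ContinuousOn S (Ioi 0) := by
  intro t ht
  have ht0 : 0 < t := ht
  refine ContinuousAt.continuousWithinAt ?_
  set M : ℝ := (t / 2)⁻¹ + |α| * Real.exp (2 * t * |α|)
  have hM : 0 ≤ M := by positivity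
  -- Mean value inequality for each multiplier, with a Lipschitz constant independent of the index.
  have hbound : ∀ s ∈ Icc (t / 2) (2 * t), ‖S s - S t‖ ≤ M * ‖s - t‖ := fun s hs => by
    have hs0 : 0 ≤ s := by linarith [hs.1]
    refine opNorm_le_of_diagonal e
      (m := fun i => ((Real.exp (s * lam i) - Real.exp (t * lam i) : ℝ) : 𝕜))
      (fun x i => ?_) (by positivity) fun i => ?_
    · rw [sub_apply, inner_sub_right, hS s hs0, hS t ht0.le, RCLike.ofReal_sub, sub_mul]
    · rw [RCLike.norm_ofReal, ← Real.norm_eq_abs]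
      refine (convex_Icc (t / 2) (2 * t)).norm_image_sub_le_of_norm_hasDerivWithin_le
        (f := fun r => Real.exp (r * lam i)) (f' := fun r => Real.exp (r * lam i) * lam i)
        (fun r _ => ?_) (fun r hr => ?_) ⟨by linarith, by linarith⟩ hs
      · simpa using (((hasDerivAt_id r).mul_const (lam i)).exp).hasDerivWithinAt
      · rw [norm_mul, Real.norm_eq_abs, Real.norm_eq_abs, Real.abs_exp, mul_comm]
        exact abs_mul_exp_le (by positivity) hr.1 hr.2 (hlam i)
  rw [ContinuousAt, tendsto_iff_norm_sub_tendsto_zero]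
  have hlim : Tendsto (fun s => M * ‖s - t‖) (𝓝 t) (𝓝 0) := by
    have : Continuous fun s : ℝ => M * ‖s - t‖ := by fun_prop
    simpa using this.tendsto t
  refine squeeze_zero' (Eventually.of_forall fun s => norm_nonneg _) ?_ hlim
  filter_upwards [Icc_mem_nhds (by linarith : t / 2 < t) (by linarith : t < 2 * t)] with s hs
  exact hbound s hs

/-- Norm continuity can fail at time zero, so it is used on `(0, T]` for measurability only;
integrability comes from the uniform bound `e^{T|α|}`. -/
theorem IsDiagonalSemigroup.intervalIntegrable (hS : IsDiagonalSemigroup S e lam)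
    (hlam : ∀ i, lam i ≤ α) {T : ℝ} (hT : 0 < T) {b : ℝ → ℝ} (hb : ContinuousOn b (Icc 0 T)) :
    IntervalIntegrable (fun t => ((b t : ℝ) : 𝕜) • S t) volume 0 T := by
  rw [intervalIntegrable_iff_integrableOn_Ioc_of_le hT.le]
  obtain ⟨K, hK⟩ := isCompact_Icc.exists_bound_of_continuousOn hb
  have hcont : ContinuousOn (fun t => ((b t : ℝ) : 𝕜) • S t) (Ioc 0 T) :=
    ContinuousOn.smul (f := fun t => ((b t : ℝ) : 𝕜))
      (RCLike.continuous_ofReal.comp_continuousOn (hb.mono Ioc_subset_Icc_self))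
      ((hS.continuousOn_Ioi hlam).mono Ioc_subset_Ioi_self)
  refine Integrable.of_bound (hcont.aestronglyMeasurable measurableSet_Ioc)
    (K * Real.exp (T * |α|)) ?_
  filter_upwards [ae_restrict_mem measurableSet_Ioc] with t ht
  have hKt := hK t (Ioc_subset_Icc_self ht)
  rw [norm_smul, RCLike.norm_ofReal]
  refine mul_le_mul hKt ?_ (norm_nonneg _) ((norm_nonneg _).trans hKt)
  refine opNorm_le_of_diagonal e (hS t ht.1.le) (by positivity) fun i => ?_
  rw [RCLike.norm_ofReal, Real.abs_exp]
  exact Real.exp_le_exp.2 (mul_le_mul_abs_of_le ht.1.le ht.2 (hlam i))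

theorem IsDiagonalizedBy.averagedSemigroup_diagonal [CompleteSpace E]
    (hA : IsDiagonalizedBy A e lam) (hlam : ∀ i, lam i ≤ α) {T : ℝ} (hT : 0 < T) {b : ℝ → ℝ}
    (hb : ContinuousOn b (Icc 0 T)) (x : E) (i : ι) :
    inner 𝕜 (e i) (averagedSemigroup A T b x) =
      ((∫ t in (0 : ℝ)..T, b t * Real.exp (lam i * t) : ℝ) : 𝕜) * inner 𝕜 (e i) x := by
  have hS := hA.opExp_diagonal hlam
  let _ : NormedSpace ℝ (E →L[𝕜] E) := NormedSpace.restrictScalars ℝ 𝕜 (E →L[𝕜] E)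
  -- A matrix coefficient is a bounded functional on operators, so it passes under the Bochner
  -- integral.
  let F : (E →L[𝕜] E) →L[𝕜] 𝕜 := (innerSL 𝕜 (e i)).comp (ContinuousLinearMap.apply 𝕜 E x)
  have h := F.intervalIntegral_comp_comm (hS.intervalIntegrable hlam hT hb)
  have hF : F (averagedSemigroup A T b) = inner 𝕜 (e i) (averagedSemigroup A T b x) := rfl
  rw [← hF, averagedSemigroup, ← h, ← RCLike.intervalIntegral_ofReal,
    ← intervalIntegral.integral_mul_const]
  refine intervalIntegral.integral_congr fun t ht => ?_
  rw [uIcc_of_le hT.le] at ht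
  simp only [F, ContinuousLinearMap.comp_apply, map_smul, ContinuousLinearMap.apply_apply,
    innerSL_apply_apply, smul_eq_mul]
  rw [hS t ht.1, RCLike.ofReal_mul, mul_comm t, mul_assoc]

end Semigroup

section Enumeration

/-! ### Enumerating the eigenvalues -/

/-- Counting predecessors is strictly monotone, and its range has no gaps, so it is an initial
segment of the naturals. -/
theorem exists_nat_lt_equiv_of_linearOrder [LinearOrder ι] (hfin : ∀ i : ι, (Iio i).Finite) :
    ∃ (N : ℕ∞) (σ : {j : ℕ // (j : ℕ∞) < N} ≃ ι), Monotone σ := by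
  let r : ι → ℕ := fun i => (Iio i).ncard
  have hr : StrictMono r := fun i j hij =>
    ncard_lt_ncard (Iio_ssubset_Iio hij) (hfin j)
  have hpred : ∀ n, n + 1 ∈ range r → n ∈ range r := by
    rintro n ⟨i, hi⟩
    have hne : (Iio i).Nonempty := nonempty_of_ncard_ne_zero (by simp only [r] at hi; omega)
    -- The immediate predecessor of `i` has exactly one predecessor fewer.
    obtain ⟨m, hm, hmax⟩ := (hfin i).exists_maximalFor id _ hne
    refine ⟨m, ?_⟩
    have hins : Iio i = insert m (Iio m) := by
      ext j
      simp only [mem_Iio, mem_insert_iff] at *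
      constructor
      · intro hj
        rcases lt_trichotomy j m with h | h | h
        · exact Or.inr h
        · exact Or.inl h
        · exact absurd (hmax hj h.le) (not_le.2 h)
      · rintro (rfl | h)
        · exact hm
        · exact h.trans hm
    simp only [r] at hi ⊢
    rw [hins, ncard_insert_of_notMem (by simp) (hfin m)] at hi
    omega
  have hlower : IsLowerSet (range r) := by
    intro m n hnm hm
    induction hnm using Nat.decreasingInduction with
    | of_succ k _ ih => exact hpred k ih
    | self => exact hm
  obtain ⟨N, hN⟩ : ∃ N : ℕ∞, ∀ j : ℕ, (j : ℕ∞) < N ↔ j ∈ range r := by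
    by_cases h : ∃ n, n ∉ range r
    · classical
      refine ⟨(Nat.find h : ℕ), fun j => ?_⟩
      rw [Nat.cast_lt]
      refine ⟨fun hj => not_not.1 (Nat.find_min h hj), fun hj => ?_⟩
      by_contra hle
      exact Nat.find_spec h (hlower (not_lt.1 hle) hj)
    · push Not at h
      exact ⟨⊤, fun j => ⟨fun _ => h j, fun _ => ENat.natCast_lt_top j⟩⟩
  let τ : {j : ℕ // (j : ℕ∞) < N} ≃ ι :=
    (Equiv.subtypeEquivRight hN).trans (Equiv.ofInjective r hr.injective).symm
  have hτ : ∀ j, r (τ j) = j := fun j => by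
    have := Equiv.apply_ofInjective_symm hr.injective (Equiv.subtypeEquivRight hN j)
    simpa [τ] using this
  refine ⟨N, τ, fun j k hjk => ?_⟩
  rw [← hr.le_iff_le, hτ, hτ]
  exact hjk

theorem exists_antitone_enumeration {lam : ι → ℝ} (hlam : Tendsto lam cofinite atBot) :
    ∃ (N : ℕ∞) (σ : {j : ℕ // (j : ℕ∞) < N} ≃ ι), Antitone (lam ∘ σ) := by
  have hfin : ∀ r : ℝ, {i | r ≤ lam i}.Finite := fun r => by
    have := hlam.eventually (eventually_lt_atBot r)
    rw [eventually_cofinite] at this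
    simpa only [not_lt] using this
  have hcount : Countable ι := by
    have huniv : (⋃ n : ℕ, {i | -(n : ℝ) ≤ lam i}) = univ := by
      refine eq_univ_of_forall fun i => mem_iUnion.2 ?_
      obtain ⟨n, hn⟩ := exists_nat_ge (-lam i)
      exact ⟨n, by simp only [mem_ofPred_eq]; linarith⟩
    rw [← countable_univ_iff, ← huniv]
    exact countable_iUnion fun n => (hfin _).countable
  obtain ⟨g, hg⟩ := hcount.exists_injective_nat
  -- Decreasing eigenvalues come first; the injection `g` breaks ties among equal ones.
  let k : ι → ℝ ×ₗ ℕ := fun i => toLex (-lam i, g i)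
  have hk : Function.Injective k := fun i j hij => hg (congrArg Prod.snd (toLex.injective hij))
  let _ : LinearOrder ι := LinearOrder.lift' k hk
  have hle : ∀ i j : ι, i ≤ j → lam j ≤ lam i := fun i j hij => by
    have : k i ≤ k j := hij
    rw [Prod.Lex.le_iff] at this
    simp only [k, ofLex_toLex] at this
    rcases this with h | h
    · linarith
    · linarith [h.1]
  obtain ⟨N, σ, hσ⟩ := exists_nat_lt_equiv_of_linearOrder (ι := ι) fun i =>
    (hfin (lam i)).subset fun j hj => hle j i (le_of_lt hj)
  exact ⟨N, σ, fun a b hab => hle _ _ (hσ hab)⟩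

variable {A : E →ₗ.[𝕜] E} {e : HilbertBasis ι 𝕜 E} {lam : ι → ℝ} {α : ℝ}

theorem mem_eigenspace_iff_mem_graph {μ : 𝕜} {x : E} :
    x ∈ eigenspace A μ ↔ (x, μ • x) ∈ A.graph := Iff.rfl

theorem IsDiagonalizedBy.mem_eigenspace_iff (hA : IsDiagonalizedBy A e lam) {μ : 𝕜} {x : E} :
    x ∈ eigenspace A μ ↔ ∀ i, (lam i : 𝕜) ≠ μ → inner 𝕜 (e i) x = 0 := by
  rw [mem_eigenspace_iff_mem_graph, hA]
  refine forall_congr' fun i => ?_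
  rw [inner_smul_right, ← sub_eq_zero, ← sub_mul, mul_eq_zero, sub_eq_zero, eq_comm,
    or_iff_not_imp_left]

theorem finite_setOf_ofReal_eq (hlam : Tendsto lam cofinite atBot) (μ : 𝕜) :
    {i | (lam i : 𝕜) = μ}.Finite := by
  have := hlam.eventually (eventually_lt_atBot (RCLike.re μ))
  rw [eventually_cofinite] at this
  refine this.subset fun i hi => ?_
  have hi' : (lam i : 𝕜) = μ := hi
  simp only [mem_ofPred_eq, ← hi', RCLike.ofReal_re, lt_irrefl, not_false_eq_true]

/-- Each value is taken only finitely often, so the basis expansion of an eigenvector is a finite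
sum and the algebraic span needs no closure. -/
theorem IsDiagonalizedBy.eigenspace_eq_span (hA : IsDiagonalizedBy A e lam)
    (hlam : Tendsto lam cofinite atBot) (μ : 𝕜) :
    eigenspace A μ = Submodule.span 𝕜 (e '' {i | (lam i : 𝕜) = μ}) := by
  apply le_antisymm
  · intro x hx
    rw [hA.mem_eigenspace_iff] at hx
    have hsum := e.hasSum_repr x
    have hfin := finite_setOf_ofReal_eq (𝕜 := 𝕜) hlam μ
    have hsum' : HasSum (fun i => e.repr x i • e i)
        (∑ i ∈ hfin.toFinset, e.repr x i • e i) :=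
      hasSum_sum_of_ne_finset_zero fun i hi => by
        rw [e.repr_apply_apply, hx i (by simpa using hi), zero_smul]
    rw [hsum.unique hsum']
    refine Submodule.sum_mem _ fun i hi => Submodule.smul_mem _ _ (Submodule.subset_span ?_)
    exact mem_image_of_mem _ (by simpa using hi)
  · rw [Submodule.span_le]
    rintro _ ⟨i, hi, rfl⟩
    have hi' : (lam i : 𝕜) = μ := hi
    rw [SetLike.mem_coe, mem_eigenspace_iff_mem_graph, ← hi']
    exact hA.basis_mem_graph i

theorem IsDiagonalizedBy.toENat_rank_eigenspace (hA : IsDiagonalizedBy A e lam)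
    (hlam : Tendsto lam cofinite atBot) (μ : 𝕜) :
    Cardinal.toENat (Module.rank 𝕜 (eigenspace A μ)) = {i | (lam i : 𝕜) = μ}.encard := by
  rw [hA.eigenspace_eq_span hlam, rank_span_set, toENat_cardinalMk,
    e.orthonormal.linearIndependent.injective.encard_image]
  exact e.orthonormal.linearIndependent.linearIndepOn_id.mono (image_subset_range _ _)

theorem IsDiagonalizedBy.exists_enumeration (hA : IsDiagonalizedBy A e lam)
    (hlam : Tendsto lam cofinite atBot) :
    ∃ (N : ℕ∞) (l : {j : ℕ // (j : ℕ∞) < N} → ℝ), IsEigenvalueEnumeration A N l := by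
  obtain ⟨N, σ, hσ⟩ := exists_antitone_enumeration hlam
  refine ⟨N, lam ∘ σ, hσ, hlam.comp σ.injective.tendsto_cofinite, fun μ => ?_⟩
  rw [hA.toENat_rank_eigenspace hlam, ← σ.injective.encard_image]
  congr 1
  ext i
  simp only [mem_image, mem_ofPred_eq, Function.comp_apply]
  exact ⟨fun ⟨j, hj, hji⟩ => hji ▸ hj, fun h => ⟨σ.symm i, by simpa using h, by simp⟩⟩

/-- Both lists contain `r` as often as the dimension of its eigenspace says, hence one contains it
exactly when the other does. -/
theorem IsDiagonalizedBy.range_eq_of_enumeration (hA : IsDiagonalizedBy A e lam)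
    (hlam : Tendsto lam cofinite atBot) {N : ℕ∞} {l : {j : ℕ // (j : ℕ∞) < N} → ℝ}
    (hl : IsEigenvalueEnumeration A N l) : range l = range lam := by
  ext r
  have h := hl.multiplicity (r : 𝕜)
  rw [hA.toENat_rank_eigenspace hlam] at h
  simp only [RCLike.ofReal_inj] at h
  have h1 : ({j | l j = r} : Set _).Nonempty ↔ {i | lam i = r}.Nonempty := by
    rw [← encard_ne_zero, ← encard_ne_zero, h]
  exact h1

theorem IsDiagonalizedBy.spectrum_eq (hA : IsDiagonalizedBy A e lam)
    (hlam : Tendsto lam cofinite atBot) :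
    spectrum A = range fun i => (lam i : 𝕜) := by
  ext z
  rw [spectrum, mem_compl_iff, ← not_iff_not, not_not]
  constructor
  · rintro ⟨R, hR⟩ ⟨i, rfl⟩
    have := hR.apply_of_mem_graph (hA.basis_mem_graph i)
    rw [sub_self, map_zero] at this
    exact e.orthonormal.ne_zero i this.symm
  · intro hz
    have hne : ∀ i, z - (lam i : 𝕜) ≠ 0 := fun i h => hz ⟨i, (sub_eq_zero.1 h).symm⟩
    -- Outside this finite set `|z - λ_i| ≥ 1`, so the multipliers `(z - λ_i)⁻¹` are bounded.
    have hfin : {i | ¬ lam i ≤ -‖z‖ - 1}.Finite :=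
      eventually_cofinite.1 (hlam.eventually (eventually_le_atBot _))
    obtain ⟨C, hC⟩ := (hfin.image fun i => ‖(z - (lam i : 𝕜))⁻¹‖).bddAbove
    obtain ⟨R, hR⟩ := exists_diagonal e (m := fun i => (z - (lam i : 𝕜))⁻¹) (C := max C 1)
      fun i => by
        by_cases hi : lam i ≤ -‖z‖ - 1
        · refine le_max_of_le_right ?_
          rw [norm_inv]
          refine inv_le_one_of_one_le₀ ?_
          have h1 := norm_sub_norm_le (lam i : 𝕜) z
          rw [RCLike.norm_ofReal, norm_sub_rev] at h1
          linarith [neg_le_abs (lam i)]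
        · exact le_max_of_le_left (hC (mem_image_of_mem _ hi))
    refine ⟨R, isResolventAt_of_graph (fun y => (hA _ _).2 fun i => ?_) fun x y hxy => ?_⟩
    · rw [inner_sub_right, inner_smul_right, hR]
      have := hne i
      field_simp
      ring
    · rw [hA] at hxy
      refine ext_inner_basis e fun i => ?_
      rw [hR, inner_sub_right, inner_smul_right, hxy, ← sub_mul, inv_mul_cancel_left₀ (hne i)]

end Enumeration

section Kernels

/-! ### Kernels and eigenvalues of diagonal operators -/

theorem mem_pointSpectrum_iff_of_diagonal {e : HilbertBasis ι 𝕜 E} {B : E →L[𝕜] E} {m : ι → 𝕜}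
    (hB : ∀ x i, inner 𝕜 (e i) (B x) = m i * inner 𝕜 (e i) x) {z : 𝕜} :
    z ∈ pointSpectrum B ↔ ∃ i, m i = z := by
  constructor
  · intro hz
    obtain ⟨v, hv⟩ := Module.End.HasEigenvalue.exists_hasEigenvector hz
    have hBv : B v = z • v := hv.apply_eq_smul
    by_contra! hne
    refine hv.2 (ext_inner_basis e fun i => ?_)
    have h := hB v i
    rw [hBv, inner_smul_right, ← sub_eq_zero, ← sub_mul] at h
    rw [inner_zero_right]
    exact (mul_eq_zero.1 h).resolve_left (sub_ne_zero.2 (hne i).symm)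
  · rintro ⟨i, rfl⟩
    refine Module.End.hasEigenvalue_of_hasEigenvector (x := e i)
      ⟨Module.End.mem_eigenspace_iff.2 ?_, e.orthonormal.ne_zero i⟩
    refine ext_inner_basis e fun j => ?_
    rw [ContinuousLinearMap.coe_coe, hB, inner_smul_right]
    rcases eq_or_ne j i with rfl | hne
    · rfl
    · rw [e.orthonormal.2 hne, mul_zero, mul_zero]

theorem ker_eq_bot_iff_of_diagonal {e : HilbertBasis ι 𝕜 E} {B : E →L[𝕜] E} {m : ι → 𝕜}
    (hB : ∀ x i, inner 𝕜 (e i) (B x) = m i * inner 𝕜 (e i) x) :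
    LinearMap.ker (B : E →ₗ[𝕜] E) = ⊥ ↔ ∀ i, m i ≠ 0 := by
  have h := not_congr (mem_pointSpectrum_iff_of_diagonal hB (z := 0))
  rw [not_exists, pointSpectrum, mem_ofPred_eq, Module.End.hasEigenvalue_iff,
    Module.End.eigenspace_zero, not_not] at h
  exact h

variable {A : E →ₗ.[𝕜] E} {e : HilbertBasis ι 𝕜 E} {lam : ι → ℝ} {α : ℝ}

theorem integral_mul_exp_eq (T l : ℝ) (b : ℝ → ℝ) :
    ∫ t in (0 : ℝ)..T, b t * Real.exp (l * t) =
      Real.exp (T * l) * ∫ t in (0 : ℝ)..T, b t * Real.exp (-l * (T - t)) := by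
  rw [← intervalIntegral.integral_const_mul]
  refine intervalIntegral.integral_congr fun t _ => ?_
  rw [mul_left_comm, ← Real.exp_add]
  ring_nf

theorem IsDiagonalizedBy.ker_Phi_eq_bot_iff [CompleteSpace E] (hA : IsDiagonalizedBy A e lam)
    (hlam : ∀ i, lam i ≤ α) {T : ℝ} (hT : 0 < T) (a : ℝ) {b : ℝ → ℝ}
    (hb : ContinuousOn b (Icc 0 T)) :
    LinearMap.ker (Phi A T a b : E →ₗ[𝕜] E) = ⊥ ↔
      ∀ i, -a ≠ ∫ t in (0 : ℝ)..T, b t * Real.exp (-lam i * (T - t)) := by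
  rw [ker_eq_bot_iff_of_diagonal (e := e) (m := fun i => ((Real.exp (T * lam i) *
    (a + ∫ t in (0 : ℝ)..T, b t * Real.exp (-lam i * (T - t))) : ℝ) : 𝕜)) fun x i => ?_]
  · refine forall_congr' fun i => not_congr ?_
    rw [RCLike.ofReal_eq_zero, mul_eq_zero, or_iff_right (Real.exp_ne_zero _),
      neg_eq_iff_add_eq_zero]
  · rw [Phi, add_apply, smul_apply, inner_add_right, inner_smul_right,
      hA.opExp_diagonal hlam T hT.le, hA.averagedSemigroup_diagonal hlam hT hb,
      integral_mul_exp_eq]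
    simp only [RCLike.ofReal_mul, RCLike.ofReal_add]
    ring

/-- In the first case `b(0) > 0` makes the integral strictly positive; in the second `l ≤ 0` makes
the exponential weight at least `1`. -/
theorem neg_ne_integral_of_nonneg {T : ℝ} (hT : 0 < T) {a l : ℝ} {b : ℝ → ℝ}
    (hb : ContinuousOn b (Icc 0 T)) (hb0 : ∀ t ∈ Icc 0 T, 0 ≤ b t) (hl : l ≤ α)
    (h : (0 ≤ a ∧ 0 < b 0) ∨ (α ≤ 0 ∧ -a < ∫ t in (0 : ℝ)..T, b t)) :
    -a ≠ ∫ t in (0 : ℝ)..T, b t * Real.exp (-l * (T - t)) := by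
  have hcont : ContinuousOn (fun t => b t * Real.exp (-l * (T - t))) (Icc 0 T) :=
    hb.mul (by fun_prop)
  refine ne_of_lt ?_
  rcases h with ⟨ha, hb00⟩ | ⟨hα, hint⟩
  · have : 0 < ∫ t in (0 : ℝ)..T, b t * Real.exp (-l * (T - t)) :=
      intervalIntegral.integral_pos hT hcont
        (fun t ht => mul_nonneg (hb0 t (Ioc_subset_Icc_self ht)) (Real.exp_pos _).le)
        ⟨0, ⟨le_rfl, hT.le⟩, mul_pos hb00 (Real.exp_pos _)⟩
    linarith
  · refine hint.trans_le (intervalIntegral.integral_mono_on hT.le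
      (hb.intervalIntegrable_of_Icc hT.le) (hcont.intervalIntegrable_of_Icc hT.le) fun t ht => ?_)
    refine le_mul_of_one_le_right (hb0 t ht) (Real.one_le_exp ?_)
    exact mul_nonneg (by linarith) (by linarith [ht.2])

theorem IsDiagonalizedBy.neg_one_notMem_pointSpectrum_iff [CompleteSpace E]
    (hA : IsDiagonalizedBy A e lam) (hlam : ∀ i, lam i ≤ α) {T : ℝ} (hT : 0 < T) {b : ℝ → ℝ}
    (hb : ContinuousOn b (Icc 0 T)) :
    (-1 : 𝕜) ∉ pointSpectrum (averagedSemigroup A T b) ↔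
      ∀ i, -1 ≠ ∫ t in (0 : ℝ)..T, b t * Real.exp (lam i * t) := by
  rw [mem_pointSpectrum_iff_of_diagonal (hA.averagedSemigroup_diagonal hlam hT hb), not_exists]
  refine forall_congr' fun i => not_congr ?_
  rw [← RCLike.ofReal_one, ← RCLike.ofReal_neg, RCLike.ofReal_inj, eq_comm]

theorem IsDiagonalizedBy.one_notMem_scaledExpSpectrum_iff (hA : IsDiagonalizedBy A e lam)
    (hlim : Tendsto lam cofinite atBot) (T b : ℝ) :
    (1 : 𝕜) ∉ scaledExpSpectrum A T b ↔ ∀ i, 1 ≠ b * Real.exp (lam i * T) := by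
  rw [scaledExpSpectrum, hA.spectrum_eq hlim, ← range_comp, mem_range, not_exists]
  refine forall_congr' fun i => not_congr ?_
  have hexp : NormedSpace.exp ((T : 𝕜) * (lam i : 𝕜)) = ((Real.exp (lam i * T) : ℝ) : 𝕜) := by
    rw [← RCLike.ofReal_mul, mul_comm T, Real.exp_eq_exp_ℝ]
    exact (NormedSpace.map_exp (RCLike.ofRealAm (K := 𝕜)) RCLike.continuous_ofReal _).symm
  rw [Function.comp_apply, hexp, ← RCLike.ofReal_mul, ← RCLike.ofReal_one, RCLike.ofReal_inj,
    eq_comm]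

end Kernels

end NonlocalEvolution

/-! ### The theorem, for an arbitrary enumeration of the eigenvalues -/

theorem proposition2 {𝕜 E : Type*} [RCLike 𝕜] [NormedAddCommGroup E] [InnerProductSpace 𝕜 E]
    [CompleteSpace E] (A : E →ₗ.[𝕜] E) (hdense : Dense (A.domain : Set E)) (hclosed : A.IsClosed)
    (hA : IsSelfAdjoint A) (α : ℝ) (hα : NonlocalEvolution.BoundedAboveBy A α)
    (hcomp : NonlocalEvolution.HasCompactResolvent A) (T : ℝ) (hT : 0 < T) :
    -- the objects in the statement exist: the semigroup generated by `A`, the operator-valued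
    -- integrals, and the list of the eigenvalues (bounded by `α`, exhausting the spectrum)
    (NonlocalEvolution.IsC0Semigroup (NonlocalEvolution.opExp A) ∧
      NonlocalEvolution.IsGenerator A (NonlocalEvolution.opExp A)) ∧
    (∀ b : ℝ → ℝ, ContinuousOn b (Set.Icc 0 T) →
      IntervalIntegrable (fun t => ((b t : ℝ) : 𝕜) • NonlocalEvolution.opExp A t)
        MeasureTheory.volume 0 T) ∧
    (∃ (N : ℕ∞) (lam : {j : ℕ // (j : ℕ∞) < N} → ℝ),
      NonlocalEvolution.IsEigenvalueEnumeration A N lam) ∧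
    ∀ (N : ℕ∞) (lam : {j : ℕ // (j : ℕ∞) < N} → ℝ),
      NonlocalEvolution.IsEigenvalueEnumeration A N lam →
      ((∀ j, lam j ≤ α) ∧
        NonlocalEvolution.spectrum A = Set.range fun j => ((lam j : ℝ) : 𝕜)) ∧
      -- (a)
      (∀ (a : ℝ) (b : ℝ → ℝ), ContinuousOn b (Set.Icc 0 T) →
        ((LinearMap.ker (NonlocalEvolution.Phi A T a b : E →ₗ[𝕜] E) = ⊥ ↔
          ∀ j, -a ≠ ∫ t in (0 : ℝ)..T, b t * Real.exp (-lam j * (T - t))) ∧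
        ((∀ t ∈ Set.Icc 0 T, 0 ≤ b t) →
          ((0 ≤ a ∧ 0 < b 0) ∨ (α ≤ 0 ∧ -a < ∫ t in (0 : ℝ)..T, b t)) →
          LinearMap.ker (NonlocalEvolution.Phi A T a b : E →ₗ[𝕜] E) = ⊥))) ∧
      -- (b)
      (∀ b : ℝ, b ≠ 0 →
        (((1 : 𝕜) ∉ NonlocalEvolution.scaledExpSpectrum A T b ↔
          ∀ j, 1 ≠ b * Real.exp (lam j * T)) ∧
        (b ≤ 1 → α < 0 → (1 : 𝕜) ∉ NonlocalEvolution.scaledExpSpectrum A T b))) ∧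
      -- (c)
      (∀ b : ℝ → ℝ, ContinuousOn b (Set.Icc 0 T) →
        (((-1 : 𝕜) ∉ NonlocalEvolution.pointSpectrum
            (NonlocalEvolution.averagedSemigroup A T b) ↔
          ∀ j, -1 ≠ ∫ t in (0 : ℝ)..T, b t * Real.exp (lam j * t)) ∧
        ((∀ t ∈ Set.Icc 0 T, 0 ≤ b t) →
          (-1 : 𝕜) ∉ NonlocalEvolution.pointSpectrum
            (NonlocalEvolution.averagedSemigroup A T b)))) := by
  obtain ⟨ι, e, lam, hdiag, hlim, hle⟩ :=
    NonlocalEvolution.exists_isDiagonalizedBy hA hα hcomp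
  refine ⟨hdiag.opExp_spec hle,
    fun b hb => (hdiag.opExp_diagonal hle).intervalIntegrable hle hT hb,
    hdiag.exists_enumeration hlim, fun N l hl => ?_⟩
  have hrange : range l = range lam := hdiag.range_eq_of_enumeration hlim hl
  -- The criteria depend only on the set of eigenvalues, so equality of ranges suffices and no
  -- bijection of indices is needed.
  have htransfer : ∀ P : ℝ → Prop, (∀ j, P (l j)) ↔ ∀ i, P (lam i) := fun P => by
    rw [← forall_mem_range (p := P), hrange, forall_mem_range]
  have hlα : ∀ j, l j ≤ α := (htransfer fun r => r ≤ α).2 hle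
  have hPhi : ∀ (a : ℝ) (b : ℝ → ℝ), ContinuousOn b (Icc 0 T) →
      (LinearMap.ker (NonlocalEvolution.Phi A T a b : E →ₗ[𝕜] E) = ⊥ ↔
        ∀ j, -a ≠ ∫ t in (0 : ℝ)..T, b t * Real.exp (-l j * (T - t))) := fun a b hb =>
    (hdiag.ker_Phi_eq_bot_iff hle hT a hb).trans
      (htransfer fun r => -a ≠ ∫ t in (0 : ℝ)..T, b t * Real.exp (-r * (T - t))).symm
  have hexp : ∀ b : ℝ, (1 : 𝕜) ∉ NonlocalEvolution.scaledExpSpectrum A T b ↔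
      ∀ j, 1 ≠ b * Real.exp (l j * T) := fun b =>
    (hdiag.one_notMem_scaledExpSpectrum_iff hlim T b).trans
      (htransfer fun r => 1 ≠ b * Real.exp (r * T)).symm
  have hpoint : ∀ b : ℝ → ℝ, ContinuousOn b (Icc 0 T) →
      ((-1 : 𝕜) ∉ NonlocalEvolution.pointSpectrum (NonlocalEvolution.averagedSemigroup A T b) ↔
        ∀ j, -1 ≠ ∫ t in (0 : ℝ)..T, b t * Real.exp (l j * t)) := fun b hb =>
    (hdiag.neg_one_notMem_pointSpectrum_iff hle hT hb).trans
      (htransfer fun r => -1 ≠ ∫ t in (0 : ℝ)..T, b t * Real.exp (r * t)).symm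
  refine ⟨⟨hlα, ?_⟩, fun a b hb => ⟨hPhi a b hb, fun hb0 h => ?_⟩,
    fun b _ => ⟨hexp b, fun hb1 hα0 => ?_⟩, fun b hb => ⟨hpoint b hb, fun hb0 => ?_⟩⟩
  · rw [hdiag.spectrum_eq hlim]
    change range ((fun r : ℝ => (r : 𝕜)) ∘ lam) = range ((fun r : ℝ => (r : 𝕜)) ∘ l)
    rw [range_comp, range_comp, hrange]
  · exact (hPhi a b hb).2 fun j =>
      NonlocalEvolution.neg_ne_integral_of_nonneg hT hb hb0 (hlα j) h
  · refine (hexp b).2 fun j => ne_of_gt ?_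
    have hlt : Real.exp (l j * T) < 1 :=
      Real.exp_lt_one_iff.2 (mul_neg_of_neg_of_pos ((hlα j).trans_lt hα0) hT)
    calc b * Real.exp (l j * T) ≤ 1 * Real.exp (l j * T) := by gcongr
      _ < 1 := by rwa [one_mul]
  · refine (hpoint b hb).2 fun j => ne_of_lt ?_
    have : 0 ≤ ∫ t in (0 : ℝ)..T, b t * Real.exp (l j * t) :=
      intervalIntegral.integral_nonneg hT.le fun t ht =>
        mul_nonneg (hb0 t ht) (Real.exp_pos _).le
    linarith
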